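/- Let $p$ be an odd prime, let $n=(p-1)/2$, let $r\in(\mathbb Z/p)^{\times}$ have order $n$, and let $$G=\mathbb Z_p\rtimes\mathbb Z_n=\langle X,Y \mid X^p=Y^n=1,\ YXY^{-1}=X^r\rangle$$ (so $\mathbb Z_n$ is identified with the subgroup $\langle r\rangle$ of $(\mathbb Z/p)^\times$ acting on $\mathbb Z_p$ by multiplication). For $F=\sum_{g\in G}a_g\,g\in\mathbb Z[G]$ let $$D(F)=\det\left(a_{gh^{-1}}\right)_{g,h\in G}$$ be its integer group determinant. Writing uniquely $F=\sum_{i=0}^{p-1}\sum_{j=0}^{n-1}a_{ij}X^iY^j$, put $$A(F)=\prod_{y\in\mathbb C,\ y^n=1}F(1,y),\qquad F(1,y)=\sum_{i=0}^{p-1}\sum_{j=0}^{n-1}a_{ij}\,y^j .$$ Let $\varepsilon=1$ if $p\equiv 1 \bmod 4$ and $\varepsilon=-1$ if $p\equiv 3\bmod 4$, and let $N$ be the norm from $\mathbb Q(\sqrt{\varepsilon p})$ to $\mathbb Q$, so that $N\left(u+v\sqrt{\varepsilon p}\right)=u^2-\varepsilon p\,v^2$ for $u,v\in\mathbb Q$.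 Then $A(F)$ is an integer for every $F\in\mathbb Z[G]$, and the set of values $D(F)$ with $F\in\mathbb Z[G]$ and $\gcd(A(F),n)=1$ is exactly the set of the integers $$m\,N\left(m+\alpha p+\tfrac12\left(p+\sqrt{\varepsilon p}\right)\beta\right)^{n},\qquad m,\alpha,\beta\in\mathbb Z,\quad \gcd(m,n)=1 .$$ -/

import Mathlib

noncomputable section

namespace IntGroupDet

/-- The group determinant `D(∑ a_g g) = det (a_{g h⁻¹})` of an element of the integral group ring;
`g` indexes the rows and `h` the columns. -/
def groupDet {G : Type*} [Group G] [Fintype G] [DecidableEq G] (F : MonoidAlgebra ℤ G) : ℤ :=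
  (Matrix.of fun g h : G => F.coeff (g * h⁻¹)).det

/-- The action of the subgroup `⟨r⟩` of `(ℤ/p)ˣ` on the (multiplicatively written) additive group
of `ℤ/p` by multiplication. -/
def mulAct (p : ℕ) (r : (ZMod p)ˣ) :
    Subgroup.zpowers r →* MulAut (Multiplicative (ZMod p)) where
  toFun u := AddEquiv.toMultiplicative (DistribMulAction.toAddEquiv (ZMod p) (u : (ZMod p)ˣ))
  map_one' := by
    ext x
    exact congrArg Multiplicative.ofAdd (one_smul (ZMod p)ˣ x.toAdd)
  map_mul' u v := by
    ext x
    exact congrArg Multiplicative.ofAdd (mul_smul (u : (ZMod p)ˣ) (v : (ZMod p)ˣ) x.toAdd)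

/-- The semidirect product `ℤ_p ⋊ ℤ_n`, where `ℤ_n` is the subgroup `⟨r⟩` of `(ℤ/p)ˣ`
(so `n` is the order of `r`) acting on `ℤ_p` by multiplication. -/
abbrev ZpZn (p : ℕ) (r : (ZMod p)ˣ) : Type :=
  SemidirectProduct (Multiplicative (ZMod p)) (Subgroup.zpowers r) (mulAct p r)

instance (p : ℕ) [NeZero p] (r : (ZMod p)ˣ) : Fintype (ZpZn p r) :=
  haveI : Finite (ZpZn p r) := Finite.of_equiv _ SemidirectProduct.equivProd.symm
  Fintype.ofFinite _

/-- The generator `X` of order `p`. -/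
def genX (p : ℕ) (r : (ZMod p)ˣ) : ZpZn p r :=
  SemidirectProduct.inl (Multiplicative.ofAdd 1)

/-- The generator `Y` of order `n = ord(r)`. -/
def genY (p : ℕ) (r : (ZMod p)ˣ) : ZpZn p r :=
  SemidirectProduct.inr ⟨r, Subgroup.mem_zpowers r⟩

theorem genX_pow (p : ℕ) (r : (ZMod p)ˣ) (k : ℕ) :
    genX p r ^ k = SemidirectProduct.inl (Multiplicative.ofAdd (k : ZMod p)) := by
  rw [genX, ← map_pow, ← ofAdd_nsmul, nsmul_one]

/-- The defining relations `X ^ p = Y ^ n = 1` and `Y X Y⁻¹ = X ^ r`, with `n = ord(r)`. -/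
theorem gen_relations (p : ℕ) [NeZero p] (r : (ZMod p)ˣ) :
    genX p r ^ p = 1 ∧ genY p r ^ orderOf r = 1 ∧
      genY p r * genX p r * (genY p r)⁻¹ = genX p r ^ (r : ZMod p).val := by
  refine ⟨?_, ?_, ?_⟩
  · rw [genX_pow]; simp
  · rw [genY, ← map_pow, ← map_one SemidirectProduct.inr]
    congr 1
    ext1
    simp [pow_orderOf_eq_one]
  · rw [genX_pow, genX, genY, ← map_inv, ← SemidirectProduct.inl_aut, ZMod.natCast_zmod_val]
    congr 1
    exact congrArg Multiplicative.ofAdd (mul_one (r : ZMod p))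

/-- `F(1, y) = ∑_{i < p} ∑_{j < n} a_{ij} y ^ j`, where `F = ∑_{i < p} ∑_{j < n} a_{ij} X ^ i Y ^ j`
and `n = ord(r)`. -/
def evalOne (p : ℕ) (r : (ZMod p)ˣ) (F : MonoidAlgebra ℤ (ZpZn p r)) (y : ℂ) : ℂ :=
  ∑ i ∈ Finset.range p, ∑ j ∈ Finset.range (orderOf r),
    (F.coeff (genX p r ^ i * genY p r ^ j) : ℂ) * y ^ j

/-- The contribution `A = ∏_{y ^ n = 1} F(1, y)` of the linear characters to the group
determinant. -/
def partA (p : ℕ) (r : (ZMod p)ˣ) (F : MonoidAlgebra ℤ (ZpZn p r)) : ℂ :=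
  ∏ y ∈ Polynomial.nthRootsFinset (orderOf r) (1 : ℂ), evalOne p r F y

/-- The sign `ε`: `1` if `p ≡ 1 mod 4` and `-1` if `p ≡ 3 mod 4` (for odd `p`). -/
def eps (p : ℕ) : ℤ := if p % 4 = 1 then 1 else -1

/-- The quadratic field `ℚ(√(εp))`, as `ℚ[s]/(s² - εp)`. -/
abbrev QuadField (p : ℕ) : Type := QuadraticAlgebra ℚ ((eps p : ℚ) * (p : ℚ)) 0

/-- The element `√(εp)` of the field `ℚ(√(εp))`. -/
def sqrtEpsP (p : ℕ) : QuadField p := QuadraticAlgebra.omega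

theorem sqrtEpsP_sq (p : ℕ) : sqrtEpsP p ^ 2 = (eps p : QuadField p) * (p : QuadField p) := by
  rw [sqrtEpsP, sq, QuadraticAlgebra.omega_mul_omega_eq_add]
  ext <;> simp [QuadraticAlgebra.re_one, QuadraticAlgebra.im_one]

/-- The norm `N(m + αp + ½(p + √(εp))β)` from `ℚ(√(εp))` to `ℚ`. -/
def normValue (p : ℕ) (m α β : ℤ) : ℚ :=
  Algebra.norm ℚ ((m : QuadField p) + (α : QuadField p) * (p : QuadField p) +
    (1 / 2 : ℚ) • (((p : QuadField p) + sqrtEpsP p) * (β : QuadField p)))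

end IntGroupDet

end

/-!
Write `H = ⟨r⟩`, which is the group of nonzero squares modulo `p`, and `ζ = exp (2πi/p)`. In suitable
coordinates the group matrix of `F` consists of `p × p` circulant blocks indexed by `H × H`
(`groupDet_eq_prod`), so `D(F)` is the product over `k` in `ℤ/p` of the determinants `B(k)` of the
representations induced from the characters `X ↦ ζ ^ k`. The factor `B(0)` is a cyclic group
determinant, equal to `A(F)` (`partA_eq_det`).

All `B(k)` are values of a single element `∑ b_x x` of the integral group ring of `ℤ/p`, namely of the
determinant `fiberDet F`, which is invariant under `H` (`domCongr_fiberDet`). Hence `b` is constant on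
the squares and on the nonsquares, and for `k ≠ 0` the value `B(k)` is
`A(F) + α p + (p ± √(εp)) β / 2`, where `√(εp)` is the quadratic Gauss sum and the sign is the
quadratic character of `k` (`exists_fourier_eq`). Each sign occurs `n` times, so the product of the
`B(k)` is the `n`-th power of the norm.

Conversely, for `m` coprime to `n` there is `f` in `ℤ[H]` with augmentation and determinant both equal
to `m` (`exists_det_cyclic_eq`). Adding to it `g(X) ∑ u`, with `u` running over `H` and `g(1) = 0`,
keeps `A = m` and changes `B(k)` by the trace `∑ g(ζ ^ (k u))` (`det_add_col_of_colSum`); the trace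
takes all the required values (`exists_fourierMatrix_det_eq`).
-/

noncomputable section

namespace IntGroupDet

open Matrix Finset

/-! ### Determinants of block circulant and cyclic group matrices -/

/-- The Fourier matrix of `ℤ/N` is invertible: by orthogonality of characters, its product with its
conjugate transpose is `N` times the identity. -/
theorem det_fourier_ne_zero {N : ℕ} [NeZero N] {ψ : AddChar (ZMod N) ℂ} (hψ : ψ.IsPrimitive) :
    (Matrix.of fun k x : ZMod N => ψ (k * x)).det ≠ 0 := by
  have h : (Matrix.of fun k x : ZMod N => ψ (k * x)) * (Matrix.of fun x k => ψ (-(x * k))) =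
      Matrix.diagonal fun _ => (N : ℂ) := by
    ext k l
    have h1 := AddChar.sum_mulShift (k - l) hψ
    simp only [Matrix.mul_apply, Matrix.of_apply, Matrix.diagonal_apply, ← AddChar.map_add_eq_mul]
    rw [← Finset.sum_congr rfl fun x _ => congrArg ψ (show x * (k - l) = k * x + -(x * l) by ring),
      h1]
    simp only [sub_eq_zero, ZMod.card, Nat.cast_ite, Nat.cast_zero]
  have h2 := congrArg Matrix.det h
  rw [Matrix.det_mul, Matrix.det_diagonal] at h2
  intro h0
  rw [h0, zero_mul] at h2
  exact Finset.prod_ne_zero_iff.2 (fun _ _ => Nat.cast_ne_zero.2 (NeZero.ne N)) h2.symm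

/-- A matrix made of `N × N` circulant blocks is conjugated by the Fourier matrix into a block diagonal
one, with one block for each character `x ↦ ψ (k x)` of `ℤ/N`. -/
theorem det_blockCirculant {N : ℕ} [NeZero N] {ψ : AddChar (ZMod N) ℂ} (hψ : ψ.IsPrimitive)
    {ι : Type*} [Fintype ι] [DecidableEq ι] (c : ι → ι → ZMod N → ℂ) :
    (Matrix.of fun i j : ι × ZMod N => c i.1 j.1 (i.2 - j.2)).det =
      ∏ k, (Matrix.of fun u v => ∑ x, c u v x * ψ (k * x)).det := by
  set M := Matrix.of fun i j : ι × ZMod N => c i.1 j.1 (i.2 - j.2)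
  set W : Matrix (ι × ZMod N) (ι × ZMod N) ℂ :=
    Matrix.of fun i j => (1 : Matrix ι ι ℂ) i.1 j.1 * ψ (i.2 * j.2)
  have hW : W.det ≠ 0 := by
    have := Matrix.det_kronecker (1 : Matrix ι ι ℂ) (Matrix.of fun k x : ZMod N => ψ (k * x))
    rw [Matrix.det_one, one_pow, one_mul] at this
    refine this ▸ pow_ne_zero _ (det_fourier_ne_zero hψ)
  have h : W * M = Matrix.blockDiagonal (fun k => Matrix.of fun u v =>
      ∑ x, c u v x * ψ (k * x)) * W := by
    ext ⟨u, k⟩ ⟨v, b⟩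
    simp only [W, M, Matrix.mul_apply, Fintype.sum_prod_type,
      Matrix.one_apply, Matrix.of_apply, Matrix.blockDiagonal_apply]
    rw [Finset.sum_eq_single u, Finset.sum_eq_single v]
    · simp only [if_true, one_mul, ite_mul, zero_mul, Finset.sum_ite_eq, Finset.mem_univ,
        Finset.sum_mul]
      refine Fintype.sum_equiv (Equiv.subRight b) _ _ fun x => ?_
      rw [mul_assoc, ← AddChar.map_add_eq_mul, ← mul_add, mul_comm]
      simp
    · intro w _ hw
      simp [hw]
    · simp
    · intro w _ hw
      simp [hw.symm]
    · simp
  have h2 := congrArg Matrix.det h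
  rw [Matrix.det_mul, Matrix.det_mul, Matrix.det_blockDiagonal, mul_comm] at h2
  exact mul_right_cancel₀ hW h2

/-- The group determinant of a cyclic group is the product over its characters. -/
theorem det_cyclic {N : ℕ} [NeZero N] {ψ : AddChar (ZMod N) ℂ} (hψ : ψ.IsPrimitive)
    {H : Type*} [Group H] [Fintype H] [DecidableEq H] (e : Multiplicative (ZMod N) ≃* H)
    (φ : H → ℂ) :
    (Matrix.of fun u v : H => φ (u * v⁻¹)).det =
      ∏ k, ∑ j, φ (e (Multiplicative.ofAdd j)) * ψ (k * j) := by
  have h := det_blockCirculant hψ (ι := Unit) fun _ _ x => φ (e (Multiplicative.ofAdd x))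
  simp only [Matrix.det_unique, Matrix.of_apply] at h
  rw [← h]
  let f : Unit × ZMod N ≃ H :=
    (Equiv.punitProd (ZMod N)).trans (Multiplicative.ofAdd.trans e.toEquiv)
  rw [← Matrix.det_submatrix_equiv_self f]
  congr 1
  ext i j
  simp [f, ofAdd_sub, div_eq_mul_inv]

theorem sum_val_lt {N a : ℕ} [NeZero N] (ha : a ≤ N) (f : ZMod N → ℂ) :
    ∑ j : ZMod N, (if j.val < a then f j else 0) = ∑ i ∈ range a, f i := by
  rw [← Finset.sum_filter]
  refine Finset.sum_bij' (fun j _ => j.val) (fun i _ => (i : ZMod N)) ?_ ?_ ?_ ?_ ?_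
  · intro j hj; simpa using hj
  · intro i hi
    have := Finset.mem_range.1 hi
    simpa [ZMod.val_natCast_of_lt (this.trans_le ha)] using this
  · intro j _; simp
  · intro i hi
    exact ZMod.val_natCast_of_lt ((Finset.mem_range.1 hi).trans_le ha)
  · intro j _; simp

theorem sum_range_natCast_zmod {N : ℕ} [NeZero N] (f : ZMod N → ℂ) :
    ∑ i ∈ range N, f i = ∑ j, f j := by
  rw [← sum_val_lt le_rfl]
  exact Finset.sum_congr rfl fun j _ => if_pos (ZMod.val_lt j)

/-- For `m` coprime to `N`, the integral group ring of a cyclic group of order `N` contains an element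
of augmentation `m` and group determinant `m`. With `m = a + N q` and `0 ≤ a < N`, it is
`(1 + g + ⋯ + g ^ (a - 1)) + q (1 + g + ⋯ + g ^ (N - 1))`: at a nontrivial character its value is
`(ζ ^ a - 1) / (ζ - 1)`, and these cyclotomic units multiply to `1` because `ζ ↦ ζ ^ a` permutes the
`ζ ≠ 1`. -/
theorem exists_det_cyclic_eq {N : ℕ} [NeZero N] {ψ : AddChar (ZMod N) ℂ} (hψ : ψ.IsPrimitive)
    {H : Type*} [Group H] [Fintype H] [DecidableEq H] (e : Multiplicative (ZMod N) ≃* H)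
    (m : ℤ) (hm : Int.gcd m N = 1) :
    ∃ c : H → ℤ, ∑ x, c x = m ∧ (Matrix.of fun u v : H => (c (u * v⁻¹) : ℂ)).det = m := by
  obtain ⟨a, ha⟩ : ∃ a : ℕ, (a : ℤ) = m % N :=
    ⟨_, Int.toNat_of_nonneg (Int.emod_nonneg _ (by exact_mod_cast NeZero.ne N))⟩
  have haN : a < N := by
    have := Int.emod_lt_of_pos m (b := N) (by exact_mod_cast NeZero.pos N)
    omega
  have hunit : IsUnit (a : ZMod N) := by
    rw [ZMod.isUnit_iff_coprime]
    have : Int.gcd (a : ℤ) N = 1 := by rw [ha, Int.gcd_emod]; exact hm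
    simpa using this
  let c : H → ℤ := fun x => (if (e.symm x).toAdd.val < a then 1 else 0) + m / N
  have hval : ∀ k : ZMod N, ∑ j, (c (e (Multiplicative.ofAdd j)) : ℂ) * ψ (k * j) =
      ∑ i ∈ range a, ψ (k * i) + (m / N : ℤ) * if k = 0 then (N : ℂ) else 0 := by
    intro k
    have h1 := AddChar.sum_mulShift k hψ
    rw [← sum_val_lt haN.le fun j => ψ (k * j)]
    simp only [c, MulEquiv.symm_apply_apply, toAdd_ofAdd, Int.cast_add, add_mul,
      Finset.sum_add_distrib, ← Finset.mul_sum]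
    congr 1
    · exact Finset.sum_congr rfl fun j _ => by split_ifs <;> simp
    · simp_rw [mul_comm k]
      rw [h1]
      push_cast [ZMod.card]
      rfl
  have h0 : (a : ℂ) + (m / N : ℤ) * (N : ℂ) = m := by
    have := Int.emod_add_mul_ediv m N
    rw [← ha, mul_comm] at this
    exact_mod_cast this
  refine ⟨c, ?_, ?_⟩
  · have h1 := hval 0
    rw [← Fintype.sum_equiv (Multiplicative.ofAdd.trans e.toEquiv)
      (fun j => c (e (Multiplicative.ofAdd j))) _ fun _ => rfl]
    simp at h1
    exact_mod_cast h1.trans h0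
  · have h1 := det_cyclic hψ e fun x => (c x : ℂ)
    rw [h1, ← Finset.mul_prod_erase _ _ (Finset.mem_univ 0), hval 0]
    have hne : ∀ k : ZMod N, k ≠ 0 → ψ k - 1 ≠ 0 := fun k hk =>
      sub_ne_zero.2 fun h => hk ((AddChar.IsPrimitive.zmod_char_eq_one_iff N hψ k).1 h)
    have h2 : ∏ k ∈ univ.erase (0 : ZMod N), ∑ j, (c (e (Multiplicative.ofAdd j)) : ℂ) * ψ (k * j)
        = ∏ k ∈ univ.erase (0 : ZMod N), ((ψ (k * a) - 1) / (ψ k - 1)) := by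
      refine Finset.prod_congr rfl fun k hk => ?_
      have hk := (Finset.mem_erase.1 hk).1
      have h3 : ∀ i : ℕ, ψ (k * i) = ψ k ^ i := fun i => by
        rw [← AddChar.map_nsmul_eq_pow, nsmul_eq_mul, mul_comm]
      rw [hval, if_neg hk, mul_zero, add_zero, eq_div_iff (hne k hk)]
      simp only [h3]
      exact geom_sum_mul _ _
    have h4 : ∏ k ∈ univ.erase (0 : ZMod N), (ψ (k * a) - 1) =
        ∏ k ∈ univ.erase (0 : ZMod N), (ψ k - 1) := by
      refine Finset.prod_bij (fun k _ => k * a) ?_ ?_ ?_ ?_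
      · intro k hk
        simpa [hunit.mul_left_eq_zero] using hk
      · intro k _ l _ h
        exact hunit.mul_left_injective h
      · intro k hk
        obtain ⟨b, hb⟩ := hunit.exists_left_inv
        refine ⟨k * b, ?_, by rw [mul_assoc, hb, mul_one]⟩
        have : k ≠ 0 := by simpa using hk
        simp only [mem_erase, mem_univ, and_true]
        intro h
        apply this
        rw [← mul_one k, ← hb, ← mul_assoc, h, zero_mul]
      · intros; rfl
    rw [h2, Finset.prod_div_distrib, h4, div_self, mul_one]
    · simpa using h0
    · exact Finset.prod_ne_zero_iff.2 fun k hk => hne k (by simpa using hk)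

/-- A rank one update. The all-ones row is a left eigenvector of `C` for the eigenvalue `m`, which is
also the determinant, so adding `w u` to every entry of row `u` adds `∑ u, w u` to the determinant. -/
theorem det_add_col_of_colSum {H : Type*} [Fintype H] [DecidableEq H] (C : Matrix H H ℂ) (m : ℂ)
    (hm : m ≠ 0) (hdet : C.det = m) (hcol : ∀ v, ∑ u, C u v = m) (w : H → ℂ) :
    (Matrix.of fun u v => C u v + w u).det = m + ∑ u, w u := by
  have hu : IsUnit C.det := by rw [hdet]; exact hm.isUnit
  let R : Matrix Unit H ℂ := Matrix.replicateRow Unit 1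
  let L : Matrix H Unit ℂ := Matrix.replicateCol Unit w
  have h : (C + L * R).det = C.det * (1 + R * C⁻¹ * L).det :=
    Matrix.det_add_replicateCol_mul_replicateRow hu w 1
  have h1 : R * C = m • R := by
    ext i v
    simp [R, Matrix.mul_apply, hcol]
  have h2 : R * C⁻¹ = m⁻¹ • R := by
    have h3 : R = m • (R * C⁻¹) := by
      rw [← Matrix.smul_mul, ← h1, Matrix.mul_assoc, Matrix.mul_nonsing_inv C hu, Matrix.mul_one]
    nth_rewrite 2 [h3]
    rw [smul_smul, inv_mul_cancel₀ hm, one_smul]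
  have h5 : (Matrix.of fun u v => C u v + w u) = C + L * R := by
    ext u v
    simp [L, R, Matrix.mul_apply]
  rw [h5, h, h2, hdet, Matrix.det_unique (n := Unit)]
  simp [L, R, Matrix.mul_apply, mul_add]
  rw [mul_inv_cancel_left₀ hm]

/-! ### The quadratic Gauss sum and functions of the quadratic character -/

theorem normValue_eq (p : ℕ) (m α β : ℤ) :
    normValue p m α β = ((m : ℚ) + α * p + p * β / 2) ^ 2 - eps p * p * (β / 2) ^ 2 := by
  have h : ∀ z : QuadField p, Algebra.norm ℚ z = z.norm := fun z =>
    QuadraticAlgebra.det_toLinearMap_eq_norm z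
  rw [normValue, h, QuadraticAlgebra.norm_def]
  simp [sqrtEpsP]
  ring

/-- The quadratic Gauss sum `∑ χ(x) ζ ^ x`, with `χ` the quadratic character modulo `p` and
`ζ = exp (2πi/p)`. It is a complex square root of `εp`. -/
def quadGauss (p : ℕ) [Fact p.Prime] : ℂ :=
  ∑ x : ZMod p, (quadraticChar (ZMod p) x : ℂ) * ZMod.stdAddChar x

variable {p : ℕ} [Fact p.Prime]

theorem ringChar_zmod_ne_two (hp : p ≠ 2) : ringChar (ZMod p) ≠ 2 := by
  rwa [ZMod.ringChar_zmod_n]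

theorem quadGauss_sq (hp : p ≠ 2) : quadGauss p ^ 2 = (eps p : ℂ) * p := by
  have h2 := ringChar_zmod_ne_two hp
  have hinj : Function.Injective (Int.castRingHom ℂ) := Int.cast_injective
  have h := gaussSum_sq (χ := (quadraticChar (ZMod p)).ringHomComp (Int.castRingHom ℂ))
    ((MulChar.ringHomComp_ne_one_iff hinj).2 (quadraticChar_ne_one h2))
    ((quadraticChar_isQuadratic (ZMod p)).comp _) (ZMod.isPrimitive_stdAddChar p)
  rw [ZMod.card] at h
  refine h.trans ?_
  congr 1
  simp only [MulChar.ringHomComp_apply, quadraticChar_neg_one h2, ZMod.card, eps,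
    eq_intCast]
  congr 1
  have hodd : p % 2 = 1 := (Fact.out : p.Prime).eq_two_or_odd.resolve_left hp
  split_ifs with h4
  · exact ZMod.χ₄_nat_one_mod_four h4
  · exact ZMod.χ₄_nat_three_mod_four (by omega)

theorem sum_quadraticChar_mul_stdAddChar (k : ZMod p) (hp : p ≠ 2) :
    ∑ x : ZMod p, (quadraticChar (ZMod p) x : ℂ) * ZMod.stdAddChar (k * x) =
      quadraticChar (ZMod p) k * quadGauss p := by
  rcases eq_or_ne k 0 with rfl | hk
  · have := quadraticChar_sum_zero (ringChar_zmod_ne_two hp)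
    simp only [zero_mul, AddChar.map_zero_eq_one, mul_one, quadraticChar_zero, Int.cast_zero]
    exact_mod_cast this
  · have h1 : (quadraticChar (ZMod p) k : ℂ) * quadraticChar (ZMod p) k = 1 := by
      exact_mod_cast (sq _).symm.trans (quadraticChar_sq_one hk)
    rw [quadGauss, Finset.mul_sum]
    refine Fintype.sum_equiv (Equiv.mulLeft₀ k hk) _ _ fun x => ?_
    simp only [Equiv.mulLeft₀_apply, map_mul, Int.cast_mul]
    rw [← mul_assoc, ← mul_assoc, h1, one_mul]

theorem sum_stdAddChar_mul (k : ZMod p) (hk : k ≠ 0) :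
    ∑ x : ZMod p, ZMod.stdAddChar (k * x) = 0 := by
  have := AddChar.sum_mulShift k (ZMod.isPrimitive_stdAddChar p)
  simpa [hk, mul_comm] using this

/-- The Fourier transform of a function of the quadratic character. With `b` equal to `b₁` on the
nonzero squares and `b₂` on the nonsquares, its value at `k ≠ 0` is `∑ b` plus an element of
`√(εp)` times the ring of integers of `ℚ(√(εp))`; here `α = -b₁` and `β = b₁ - b₂`. -/
theorem exists_fourier_eq (hp : p ≠ 2) (b : ZMod p → ℤ)
    (hb : ∀ x y, quadraticChar (ZMod p) x = quadraticChar (ZMod p) y → b x = b y) :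
    ∃ α β : ℤ, ∀ k : ZMod p, k ≠ 0 → ∑ x, (b x : ℂ) * ZMod.stdAddChar (k * x) =
      ∑ x, (b x : ℂ) + α * p + p * β / 2 +
        quadraticChar (ZMod p) k * (β / 2 * quadGauss p) := by
  obtain ⟨s, hs⟩ := quadraticChar_exists_neg_one (F := ZMod p) (ringChar_zmod_ne_two hp)
  refine ⟨-b 1, b 1 - b s, fun k hk => ?_⟩
  have hbx : ∀ x, (b x : ℂ) = (b 1 + b s) / 2 + (b 1 - b s) / 2 * quadraticChar (ZMod p) x +
      if x = 0 then (b 0 - (b 1 + b s) / 2 : ℂ) else 0 := by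
    intro x
    split_ifs with h
    · subst h; simp
    · rcases quadraticChar_dichotomy h with h1 | h1
      · rw [hb x 1 (by rw [h1, map_one]), h1]; push_cast; ring
      · rw [hb x s (by rw [h1, hs]), h1]; push_cast; ring
  have h0 : ∑ x : ZMod p, (quadraticChar (ZMod p) x : ℂ) = 0 := by
    exact_mod_cast quadraticChar_sum_zero (ringChar_zmod_ne_two hp)
  rw [Finset.sum_congr rfl fun x _ => hbx x,
    Finset.sum_congr rfl fun x _ => congrArg (· * ZMod.stdAddChar (k * x)) (hbx x)]
  simp only [add_mul, Finset.sum_add_distrib, mul_assoc, ← Finset.mul_sum,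
    sum_quadraticChar_mul_stdAddChar k hp, sum_stdAddChar_mul k hk, h0]
  simp only [ite_mul, zero_mul, Finset.sum_ite_eq', Finset.mem_univ, if_true, mul_zero,
    AddChar.map_zero_eq_one, Finset.sum_const, Finset.card_univ, ZMod.card, nsmul_eq_mul]
  push_cast
  ring

/-- Half of the `2n` nonzero residues are squares, so conjugate factors `P + Q` and `P - Q` each occur
`n` times. -/
theorem prod_add_quadraticChar_mul (n : ℕ) (hn : p = 2 * n + 1) (P Q : ℂ) :
    ∏ k ∈ univ.erase (0 : ZMod p), (P + quadraticChar (ZMod p) k * Q) = (P ^ 2 - Q ^ 2) ^ n := by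
  have hp : p ≠ 2 := by omega
  set S := (univ.erase (0 : ZMod p)).filter fun k => quadraticChar (ZMod p) k = 1
  set T := (univ.erase (0 : ZMod p)).filter fun k => ¬ quadraticChar (ZMod p) k = 1
  have hS : ∀ k ∈ S, quadraticChar (ZMod p) k = 1 := fun k hk => (mem_filter.1 hk).2
  have hT : ∀ k ∈ T, quadraticChar (ZMod p) k = -1 := fun k hk =>
    (quadraticChar_dichotomy (mem_erase.1 (mem_filter.1 hk).1).1).resolve_left (mem_filter.1 hk).2
  have h1 : #S + #T = 2 * n := by
    rw [Finset.card_filter_add_card_filter_not, card_erase_of_mem (mem_univ _), card_univ,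
      ZMod.card, hn, Nat.add_sub_cancel]
  have h2 : (#S : ℤ) - #T = 0 := by
    rw [← quadraticChar_sum_zero (ringChar_zmod_ne_two hp), ← Finset.add_sum_erase _ _ (mem_univ 0),
      quadraticChar_zero, zero_add, ← Finset.sum_filter_add_sum_filter_not _
        (fun k => quadraticChar (ZMod p) k = 1), Finset.sum_congr rfl hS, Finset.sum_congr rfl hT]
    simp [sub_eq_add_neg]
  have hSn : #S = n := by omega
  have hTn : #T = n := by omega
  rw [← Finset.prod_filter_mul_prod_filter_not _ (fun k => quadraticChar (ZMod p) k = 1),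
    Finset.prod_congr rfl fun k hk => by rw [hS k hk],
    Finset.prod_congr (s₁ := T) rfl fun k hk => by rw [hT k hk], Finset.prod_const,
    Finset.prod_const, hSn, hTn, ← mul_pow]
  push_cast
  ring

variable {n : ℕ} {r : (ZMod p)ˣ}

/-- The subgroup of order `(p - 1) / 2` consists of the squares: it fills the group of `n`-th roots of
unity, and Euler's criterion applies. -/
theorem mem_zpowers_iff_quadraticChar (hn : p = 2 * n + 1) (hr : orderOf r = n) (u : (ZMod p)ˣ) :
    u ∈ Subgroup.zpowers r ↔ quadraticChar (ZMod p) u = 1 := by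
  have hn0 : n ≠ 0 := by
    rintro rfl
    exact (Fact.out : p.Prime).ne_one hn
  have : NeZero n := ⟨hn0⟩
  have h : Subgroup.zpowers r = rootsOfUnity n (ZMod p) := by
    refine Subgroup.eq_of_le_of_card_ge ?_ ?_
    · rw [Subgroup.zpowers_le, mem_rootsOfUnity, ← hr, pow_orderOf_eq_one]
    · rw [Nat.card_zpowers, hr]
      exact card_rootsOfUnity (ZMod p) n
  have hp2 : p / 2 = n := by omega
  rw [h, mem_rootsOfUnity', quadraticChar_one_iff_isSquare u.ne_zero,
    ZMod.euler_criterion p u.ne_zero, hp2]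

/-- The Gaussian periods of the subgroup of squares. -/
theorem sum_zpowers_stdAddChar (hn : p = 2 * n + 1) (hr : orderOf r = n) (t : ZMod p)
    (ht : t ≠ 0) :
    ∑ u : Subgroup.zpowers r, ZMod.stdAddChar (((u : (ZMod p)ˣ) : ZMod p) * t) =
      (-1 + quadraticChar (ZMod p) t * quadGauss p) / 2 := by
  have hp : p ≠ 2 := by omega
  have h1 : ∑ u : Subgroup.zpowers r, ZMod.stdAddChar (((u : (ZMod p)ˣ) : ZMod p) * t) =
      ∑ x : ZMod p with quadraticChar (ZMod p) x = 1, ZMod.stdAddChar (x * t) := by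
    refine Finset.sum_bij (fun u _ => ((u : (ZMod p)ˣ) : ZMod p)) ?_ ?_ ?_ ?_
    · intro u _
      simpa using (mem_zpowers_iff_quadraticChar hn hr u).1 u.2
    · intro u _ v _ h
      exact Subtype.ext (Units.ext h)
    · intro x hx
      have hx := (mem_filter.1 hx).2
      have hx0 : x ≠ 0 := by
        rintro rfl
        simp at hx
      exact ⟨⟨Units.mk0 x hx0, (mem_zpowers_iff_quadraticChar hn hr _).2 hx⟩, mem_univ _, rfl⟩
    · intros; rfl
  have h2 : ∀ x : ZMod p, (if quadraticChar (ZMod p) x = 1 then ZMod.stdAddChar (x * t) else 0) =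
      (ZMod.stdAddChar (t * x) + quadraticChar (ZMod p) x * ZMod.stdAddChar (t * x)
        - if x = 0 then 1 else 0) / 2 := by
    intro x
    rw [mul_comm]
    rcases eq_or_ne x 0 with rfl | hx
    · simp
    · rcases quadraticChar_dichotomy hx with h | h <;> simp [h, hx]
  rw [h1, Finset.sum_filter, Finset.sum_congr rfl fun x _ => h2 x, ← Finset.sum_div,
    Finset.sum_sub_distrib, Finset.sum_add_distrib, sum_stdAddChar_mul t ht,
    sum_quadraticChar_mul_stdAddChar t hp]
  simp
  ring

/-! ### Fourier decomposition of the group determinant -/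

/-- The coefficient of `X ^ x u` in `F`, for `x` in `ℤ/p` and `u` in `⟨r⟩`. -/
def fiberCoeff (F : MonoidAlgebra ℤ (ZpZn p r)) (x : ZMod p) (u : Subgroup.zpowers r) : ℤ :=
  F.coeff ⟨Multiplicative.ofAdd x, u⟩

/-- The matrix of `F` in the representation induced from the character `x ↦ ζ ^ (k x)` of `ℤ/p`, where
`ζ = exp (2πi/p)`, its rows and columns indexed by `⟨r⟩`. For `k = 0` it is the group matrix over
`⟨r⟩` of the image of `F`. -/
def fourierMatrix (F : MonoidAlgebra ℤ (ZpZn p r)) (k : ZMod p) :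
    Matrix (Subgroup.zpowers r) (Subgroup.zpowers r) ℂ :=
  Matrix.of fun u v => ∑ x : ZMod p,
    (fiberCoeff F (((u : (ZMod p)ˣ) : ZMod p) * x) (u * v⁻¹) : ℂ) * ZMod.stdAddChar (k * x)

/-- In the coordinates `(x, u) ↦ X ^ (u x) u` of the group, the group matrix has circulant blocks. -/
theorem groupDet_eq_prod (F : MonoidAlgebra ℤ (ZpZn p r)) :
    (groupDet F : ℂ) = ∏ k, (fourierMatrix F k).det := by
  have h := det_blockCirculant (ZMod.isPrimitive_stdAddChar p)
    fun (u v : Subgroup.zpowers r) (x : ZMod p) =>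
      (fiberCoeff F (((u : (ZMod p)ˣ) : ZMod p) * x) (u * v⁻¹) : ℂ)
  refine Eq.trans ?_ h
  let e : Subgroup.zpowers r × ZMod p ≃ ZpZn p r :=
    { toFun := fun i => ⟨Multiplicative.ofAdd (((i.1 : (ZMod p)ˣ) : ZMod p) * i.2), i.1⟩
      invFun := fun g => (g.right, ((g.right⁻¹ : Subgroup.zpowers r) : (ZMod p)ˣ) * g.left.toAdd)
      left_inv := fun i => Prod.ext rfl (Units.inv_mul_cancel_left (i.1 : (ZMod p)ˣ) i.2)
      right_inv := fun g => SemidirectProduct.ext (congrArg Multiplicative.ofAdd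
        (Units.mul_inv_cancel_left (g.right : (ZMod p)ˣ) g.left.toAdd)) rfl }
  rw [groupDet, ← Matrix.det_submatrix_equiv_self e, ← eq_intCast (Int.castRingHom ℂ),
    RingHom.map_det]
  congr 1
  ext i j
  simp only [RingHom.mapMatrix_apply, Matrix.map_apply, Matrix.submatrix_apply, Matrix.of_apply,
    fiberCoeff, eq_intCast, e, Equiv.coe_fn_mk]
  congr 2
  ext
  · have hsymm : ∀ (w : Subgroup.zpowers r) (x : ZMod p),
        (mulAct p r w).symm (Multiplicative.ofAdd (((w : (ZMod p)ˣ) : ZMod p) * x)) =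
          Multiplicative.ofAdd x := fun w x => (MulEquiv.symm_apply_eq _).2 rfl
    have hact : ∀ (w : Subgroup.zpowers r) (y : Multiplicative (ZMod p)),
        mulAct p r w y = Multiplicative.ofAdd (((w : (ZMod p)ˣ) : ZMod p) * y.toAdd) :=
      fun _ _ => rfl
    simp [hact, hsymm, sub_eq_add_neg, mul_add]
  · rfl

/-- The common source, in the group ring of `ℤ/p`, of the determinants of all the matrices
`fourierMatrix F k`: the same determinant with the formal element `x` in place of `ζ ^ (k x)`. -/
def fiberDet (F : MonoidAlgebra ℤ (ZpZn p r)) : MonoidAlgebra ℤ (Multiplicative (ZMod p)) :=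
  (Matrix.of fun u v : Subgroup.zpowers r => MonoidAlgebra.ofCoeff (Finsupp.equivFunOnFinite.symm
    fun x : Multiplicative (ZMod p) => F.coeff ⟨mulAct p r u x, u * v⁻¹⟩)).det

/-- `fiberDet F` is invariant under `⟨r⟩`: the action of `w` translates the row and column indices of
its matrix. -/
theorem domCongr_fiberDet (F : MonoidAlgebra ℤ (ZpZn p r)) (w : Subgroup.zpowers r) :
    MonoidAlgebra.domCongr ℤ ℤ (mulAct p r w) (fiberDet F) = fiberDet F := by
  rw [fiberDet, AlgEquiv.map_det, ← Matrix.det_submatrix_equiv_self (Equiv.mulRight w)]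
  congr 1
  ext u v x
  simp only [AlgEquiv.mapMatrix_apply, Matrix.map_apply, Matrix.submatrix_apply, Matrix.of_apply,
    MonoidAlgebra.coeff_domCongr, Equiv.coe_mulRight]
  simp only [Finsupp.equivFunOnFinite_symm_apply_apply, map_mul, MulAut.mul_apply]
  simp

/-- The evaluation of the group ring of `ℤ/p` at the character `x ↦ ζ ^ (k x)`, `ζ = exp (2πi/p)`. -/
def evalChar (p : ℕ) [Fact p.Prime] (k : ZMod p) :
    MonoidAlgebra ℤ (Multiplicative (ZMod p)) →ₐ[ℤ] ℂ :=
  MonoidAlgebra.lift ℤ ℂ _ (AddChar.mulShift ZMod.stdAddChar k).toMonoidHom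

theorem evalChar_apply (k : ZMod p) (b : MonoidAlgebra ℤ (Multiplicative (ZMod p))) :
    evalChar p k b =
      ∑ x : ZMod p, (b.coeff (Multiplicative.ofAdd x) : ℂ) * ZMod.stdAddChar (k * x) := by
  rw [evalChar, MonoidAlgebra.lift_apply, Finsupp.sum_fintype _ _ fun _ => by simp]
  refine Fintype.sum_equiv Multiplicative.toAdd _ _ fun x => ?_
  rw [zsmul_eq_mul]
  rfl

theorem evalChar_fiberDet (F : MonoidAlgebra ℤ (ZpZn p r)) (k : ZMod p) :
    evalChar p k (fiberDet F) = (fourierMatrix F k).det := by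
  rw [fiberDet, AlgHom.map_det]
  congr 1
  ext u v
  simp only [AlgHom.mapMatrix_apply, Matrix.map_apply, Matrix.of_apply, evalChar_apply,
    fourierMatrix]
  rfl

/-- The generator `r` of the group `⟨r⟩`. -/
def zpowersGen (r : (ZMod p)ˣ) : Subgroup.zpowers r := ⟨r, Subgroup.mem_zpowers r⟩

theorem mem_zpowers_zpowersGen (r : (ZMod p)ˣ) (x : Subgroup.zpowers r) :
    x ∈ Subgroup.zpowers (zpowersGen r) := by
  obtain ⟨x, k, rfl⟩ := x
  exact ⟨k, Subtype.ext (by simp [zpowersGen])⟩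

theorem partA_eq_det (F : MonoidAlgebra ℤ (ZpZn p r)) :
    partA p r F = (fourierMatrix F 0).det := by
  set n := orderOf r with hn
  have : NeZero n := ⟨(orderOf_pos r).ne'⟩
  let g := zpowersGen r
  have hg := mem_zpowers_zpowersGen r
  let e := zmodMulEquivOfGenerator hg (Nat.card_zpowers r)
  have h := det_cyclic (ZMod.isPrimitive_stdAddChar n) e
    fun w => ∑ x : ZMod p, (fiberCoeff F x w : ℂ)
  have h0 : fourierMatrix F 0 = Matrix.of fun u v : Subgroup.zpowers r =>
      ∑ x : ZMod p, (fiberCoeff F x (u * v⁻¹) : ℂ) := by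
    ext u v
    simp only [fourierMatrix, Matrix.of_apply, zero_mul, AddChar.map_zero_eq_one, mul_one]
    exact Fintype.sum_equiv (Equiv.mulLeft₀ _ (u : (ZMod p)ˣ).ne_zero) _ _ fun x => rfl
  rw [h0, h, partA]
  refine (Finset.prod_bij (fun (k : ZMod n) _ => ZMod.stdAddChar k) ?_ ?_ ?_ ?_).symm
  · intro k _
    rw [Polynomial.mem_nthRootsFinset (orderOf_pos r), ← AddChar.map_nsmul_eq_pow]
    simp [← hn]
  · intro k _ l _ h
    exact ZMod.injective_stdAddChar h
  · intro y hy
    rw [Polynomial.mem_nthRootsFinset (orderOf_pos r)] at hy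
    have hζ : IsPrimitiveRoot (ZMod.stdAddChar (1 : ZMod n)) n := by
      have := ZMod.stdAddChar_coe (N := n) 1
      rw [Int.cast_one, Int.cast_one, mul_one] at this
      rw [this]
      exact Complex.isPrimitiveRoot_exp n (NeZero.ne n)
    obtain ⟨i, _, hi⟩ := hζ.eq_pow_of_pow_eq_one hy
    refine ⟨i, mem_univ _, ?_⟩
    rw [← hi, ← AddChar.map_nsmul_eq_pow, nsmul_one]
  · intro k _
    rw [evalOne, Finset.sum_comm]
    have h1 : ∀ j : ℕ, e (Multiplicative.ofAdd (j : ZMod n)) = g ^ j := fun j => by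
      have := zmodMulEquivOfGenerator_apply_ofAdd_intCast hg (Nat.card_zpowers r) j
      simpa [e] using this
    rw [← sum_range_natCast_zmod]
    refine Finset.sum_congr rfl fun j _ => ?_
    rw [h1, ← sum_range_natCast_zmod fun x => (fiberCoeff F x (g ^ j) : ℂ), Finset.sum_mul]
    refine Finset.sum_congr rfl fun i _ => ?_
    have h2 : genX p r ^ i * genY p r ^ j = ⟨Multiplicative.ofAdd (i : ZMod p), g ^ j⟩ := by
      rw [genX_pow, genY, ← map_pow, SemidirectProduct.mk_eq_inl_mul_inr]
      rfl
    rw [h2, ← AddChar.map_nsmul_eq_pow, nsmul_eq_mul, mul_comm k]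
    rfl

/-! ### The two inclusions -/

/-- The identification of `√(εp)` with the Gauss sum turns the product over the nontrivial characters
into a power of the norm. -/
theorem groupDet_eq_mul_normValue_pow (hn : p = 2 * n + 1)
    (F : MonoidAlgebra ℤ (ZpZn p r)) (m α β : ℤ) (h0 : (fourierMatrix F 0).det = m)
    (hF : ∀ k : ZMod p, k ≠ 0 → (fourierMatrix F k).det =
      m + α * p + p * β / 2 + quadraticChar (ZMod p) k * (β / 2 * quadGauss p)) :
    (groupDet F : ℚ) = (m : ℚ) * normValue p m α β ^ n := by
  have h : (groupDet F : ℂ) = ((m : ℚ) * normValue p m α β ^ n : ℚ) := by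
    rw [groupDet_eq_prod, ← Finset.mul_prod_erase _ _ (mem_univ 0), h0,
      Finset.prod_congr rfl fun k hk => hF k (mem_erase.1 hk).1,
      prod_add_quadraticChar_mul n hn, mul_pow (_ / 2), quadGauss_sq (by omega), normValue_eq]
    push_cast
    ring
  exact_mod_cast h

/-- The coefficients of `fiberDet F` are integers depending only on the quadratic character, so its
values at the nontrivial characters are congruent to its value `m` at the trivial one, modulo
`√(εp)`. -/
theorem exists_det_fourierMatrix_eq (hn : p = 2 * n + 1) (hr : orderOf r = n)
    (F : MonoidAlgebra ℤ (ZpZn p r)) :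
    ∃ m α β : ℤ, (fourierMatrix F 0).det = m ∧ ∀ k : ZMod p, k ≠ 0 → (fourierMatrix F k).det =
      m + α * p + p * β / 2 + quadraticChar (ZMod p) k * (β / 2 * quadGauss p) := by
  have hp : p ≠ 2 := by omega
  let b : ZMod p → ℤ := fun x => (fiberDet F).coeff (Multiplicative.ofAdd x)
  have hinv : ∀ (w : Subgroup.zpowers r) (x : ZMod p),
      b (((w : (ZMod p)ˣ) : ZMod p) * x) = b x := by
    intro w x
    have h := congrArg (fun f => f.coeff (mulAct p r w (Multiplicative.ofAdd x)))
      (domCongr_fiberDet F w)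
    simp only [MonoidAlgebra.coeff_domCongr, MulEquiv.symm_apply_apply] at h
    exact h.symm
  have hb : ∀ x y, quadraticChar (ZMod p) x = quadraticChar (ZMod p) y → b x = b y := by
    intro x y hxy
    rcases eq_or_ne y 0 with rfl | hy
    · rw [quadraticChar_zero, quadraticChar_eq_zero_iff] at hxy
      rw [hxy]
    · have hx : x ≠ 0 := by
        rintro rfl
        rw [quadraticChar_zero, eq_comm, quadraticChar_eq_zero_iff] at hxy
        exact hy hxy
      have hxy0 : x * y ≠ 0 := mul_ne_zero hx hy
      have hu : quadraticChar (ZMod p) (x * y⁻¹) = 1 := by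
        have h1 : x * y⁻¹ = x * y * y⁻¹ ^ 2 := by field_simp
        rw [h1, map_mul, quadraticChar_sq_one' (inv_ne_zero hy), mul_one, map_mul, hxy, ← sq,
          quadraticChar_sq_one hy]
      have hmem := (mem_zpowers_iff_quadraticChar hn hr
        (Units.mk0 (x * y⁻¹) (mul_ne_zero hx (inv_ne_zero hy)))).2 hu
      have h := hinv ⟨_, hmem⟩ y
      simpa [hy] using h
  obtain ⟨α, β, h⟩ := exists_fourier_eq hp b hb
  refine ⟨∑ x, b x, α, β, ?_, fun k hk => ?_⟩
  · rw [← evalChar_fiberDet, evalChar_apply]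
    simp [b]
  · rw [← evalChar_fiberDet, evalChar_apply, Int.cast_sum]
    exact h k hk

/-- Every triple of parameters with `m` coprime to `n` is realized (for `m = 0` only the value at the
trivial character is needed, as it forces `D(F) = 0`), by `F = f(Y) + g(X) (1 + Y + ⋯ + Y ^ (n - 1))`
with `f` of augmentation and determinant `m` on `⟨r⟩`, and `g(1) = 0`. The second summand acts on the
induced representations by a matrix of rank one, which changes the determinant by a trace of `g(ζ)`. -/
theorem exists_fourierMatrix_det_eq (hn : p = 2 * n + 1) (hr : orderOf r = n)
    (m α β : ℤ) (hm : Int.gcd m n = 1) :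
    ∃ F : MonoidAlgebra ℤ (ZpZn p r), (fourierMatrix F 0).det = m ∧
      (m ≠ 0 → ∀ k : ZMod p, k ≠ 0 → (fourierMatrix F k).det =
      m + α * p + p * β / 2 + quadraticChar (ZMod p) k * (β / 2 * quadGauss p)) := by
  have hp : p ≠ 2 := by omega
  have : NeZero n := ⟨by rintro rfl; exact (Fact.out : p.Prime).ne_one hn⟩
  obtain ⟨s, hs⟩ := quadraticChar_exists_neg_one' (F := ZMod p) (ringChar_zmod_ne_two hp)
  obtain ⟨c, hcm, hc⟩ := exists_det_cyclic_eq (ZMod.isPrimitive_stdAddChar n)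
    (zmodMulEquivOfGenerator (mem_zpowers_zpowersGen r) ((Nat.card_zpowers r).trans hr)) m hm
  let δ : ZMod p → ZMod p → ℤ := fun y x => if x = y then 1 else 0
  -- As `s` is not a square, `1 - X ^ s` has trace `(p + √(εp)) / 2` and `2 - X - X ^ s` has trace `p`.
  let G : ZMod p → ℤ := fun x => α * (2 * δ 0 x - δ 1 x - δ s x) + β * (δ 0 x - δ s x)
  let F : MonoidAlgebra ℤ (ZpZn p r) := MonoidAlgebra.ofCoeff (Finsupp.equivFunOnFinite.symm
    fun g => c g.right * δ 0 g.left.toAdd + G g.left.toAdd)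
  have hFc : ∀ x w, fiberCoeff F x w = c w * δ 0 x + G x := fun _ _ => rfl
  let ψ : AddChar (ZMod p) ℂ := ZMod.stdAddChar
  have hδ : ∀ (t y : ZMod p), ∑ x, (δ y x : ℂ) * ψ (t * x) = ψ (t * y) := by
    intro t y
    simp [δ]
  let w : ZMod p → Subgroup.zpowers r → ℂ := fun k u =>
    α * (2 - ψ (((u⁻¹ : (ZMod p)ˣ) : ZMod p) * k) - ψ (((u⁻¹ : (ZMod p)ˣ) : ZMod p) * (k * s))) +
      β * (1 - ψ (((u⁻¹ : (ZMod p)ˣ) : ZMod p) * (k * s)))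
  let C : Matrix (Subgroup.zpowers r) (Subgroup.zpowers r) ℂ :=
    Matrix.of fun u v => (c (u * v⁻¹) : ℂ)
  have hM : ∀ k, fourierMatrix F k = Matrix.of fun u v => C u v + w k u := by
    intro k
    ext u v
    have h1 : ∑ x : ZMod p, (fiberCoeff F (((u : (ZMod p)ˣ) : ZMod p) * x) (u * v⁻¹) : ℂ) *
        ψ (k * x) = ∑ x : ZMod p, (fiberCoeff F x (u * v⁻¹) : ℂ) *
          ψ ((((u⁻¹ : (ZMod p)ˣ) : ZMod p) * k) * x) := by
      refine Fintype.sum_equiv (Equiv.mulLeft₀ _ (u : (ZMod p)ˣ).ne_zero) _ _ fun x => ?_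
      rw [Equiv.mulLeft₀_apply, mul_right_comm, Units.inv_mul_cancel_left, mul_comm x]
    simp only [fourierMatrix, Matrix.of_apply, C]
    refine h1.trans ?_
    set t := ((u⁻¹ : (ZMod p)ˣ) : ZMod p) * k with ht
    have h2 : ∀ x, (fiberCoeff F x (u * v⁻¹) : ℂ) * ψ (t * x) =
        (c (u * v⁻¹) + 2 * α + β) * (δ 0 x * ψ (t * x)) - α * (δ 1 x * ψ (t * x)) -
          (α + β) * (δ s x * ψ (t * x)) := by
      intro x
      rw [hFc]
      simp only [G]
      push_cast
      ring
    rw [Finset.sum_congr rfl fun x _ => h2 x, Finset.sum_sub_distrib, Finset.sum_sub_distrib,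
      ← Finset.mul_sum, ← Finset.mul_sum, ← Finset.mul_sum, hδ, hδ, hδ]
    simp only [w, ← mul_assoc, ← ht, mul_zero, AddChar.map_zero_eq_one, mul_one]
    ring
  refine ⟨F, ?_, fun hm0 k hk => ?_⟩
  · rw [hM, ← hc]
    congr 1
    ext u v
    have hw0 : w 0 u = 0 := by
      simp only [w, zero_mul, mul_zero, AddChar.map_zero_eq_one]
      ring
    rw [Matrix.of_apply, hw0, add_zero]
  · have hsum : ∀ t : ZMod p, t ≠ 0 →
        ∑ u : Subgroup.zpowers r, ψ (((u⁻¹ : (ZMod p)ˣ) : ZMod p) * t) =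
          (-1 + quadraticChar (ZMod p) t * quadGauss p) / 2 := by
      intro t ht
      rw [← sum_zpowers_stdAddChar hn hr t ht]
      exact Fintype.sum_equiv (Equiv.inv _) _ _ fun u => rfl
    have hw : ∑ u, w k u = α * p + p * β / 2 +
        quadraticChar (ZMod p) k * (β / 2 * quadGauss p) := by
      have hcard : (Fintype.card (Subgroup.zpowers r) : ℂ) = n := by
        rw [Fintype.card_eq_nat_card, Nat.card_zpowers, hr]
      have hpn : (p : ℂ) = 2 * n + 1 := by exact_mod_cast congrArg (Nat.cast : ℕ → ℂ) hn
      simp only [w, Finset.sum_add_distrib, ← Finset.mul_sum, Finset.sum_sub_distrib,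
        hsum k hk, hsum (k * s) (mul_ne_zero hk s.ne_zero), Finset.sum_const, Finset.card_univ,
        nsmul_eq_mul, hcard, map_mul, hs, hpn]
      push_cast
      ring
    rw [hM, det_add_col_of_colSum C m (by exact_mod_cast hm0) hc ?_ (w k), hw]
    · ring
    · intro v
      rw [← hcm, Int.cast_sum]
      exact Fintype.sum_equiv (Equiv.mulRight v⁻¹) _ _ fun u => rfl

end IntGroupDet

end

theorem mainTheorem2 (p n : ℕ) [Fact p.Prime] (hn : p = 2 * n + 1)
    (r : (ZMod p)ˣ) (hr : orderOf r = n) :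
    (∀ F : MonoidAlgebra ℤ (IntGroupDet.ZpZn p r), ∃ A : ℤ, IntGroupDet.partA p r F = (A : ℂ)) ∧
    ∀ D : ℤ,
      (∃ F : MonoidAlgebra ℤ (IntGroupDet.ZpZn p r), ∃ A : ℤ,
          IntGroupDet.partA p r F = (A : ℂ) ∧ Int.gcd A n = 1 ∧ IntGroupDet.groupDet F = D) ↔
      (∃ m α β : ℤ, Int.gcd m n = 1 ∧
          (D : ℚ) = (m : ℚ) * IntGroupDet.normValue p m α β ^ n) := by
  refine ⟨fun F => ?_, fun D => ⟨?_, ?_⟩⟩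
  · obtain ⟨m, α, β, h0, _⟩ := IntGroupDet.exists_det_fourierMatrix_eq hn hr F
    exact ⟨m, (IntGroupDet.partA_eq_det F).trans h0⟩
  · rintro ⟨F, A, hA, hgcd, rfl⟩
    obtain ⟨m, α, β, h0, h⟩ := IntGroupDet.exists_det_fourierMatrix_eq hn hr F
    have hAm : A = m := by exact_mod_cast hA.symm.trans ((IntGroupDet.partA_eq_det F).trans h0)
    exact ⟨m, α, β, hAm ▸ hgcd, IntGroupDet.groupDet_eq_mul_normValue_pow hn F m α β h0 h⟩
  · rintro ⟨m, α, β, hm, hD⟩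
    obtain ⟨F, h0, h⟩ := IntGroupDet.exists_fourierMatrix_det_eq (r := r) hn hr m α β hm
    refine ⟨F, m, (IntGroupDet.partA_eq_det F).trans h0, hm, ?_⟩
    -- For `m = 0` both sides vanish, through the factor of the trivial character.
    rcases eq_or_ne m 0 with rfl | hm0
    · have h1 : (IntGroupDet.groupDet F : ℂ) = 0 := by
        rw [IntGroupDet.groupDet_eq_prod]
        exact Finset.prod_eq_zero (Finset.mem_univ 0) (by simpa using h0)
      have h2 : (D : ℚ) = 0 := by simpa using hD
      have h3 : IntGroupDet.groupDet F = 0 := by exact_mod_cast h1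
      rw [h3]
      exact_mod_cast h2.symm
    · have h1 := IntGroupDet.groupDet_eq_mul_normValue_pow hn F m α β h0 (h hm0)
      exact_mod_cast h1.trans hD.symm
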